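/- Let $A\in\mathbb C^{n\times n}$, $b,d\in\mathbb C^n$, $t\in\mathbb R$, and consider the system $x'=Ax+bu$, $y=d^Hx$, whose scalar impulse response is $t\mapsto d^He^{tA}b$. Let $\lambda_1,\dots,\lambda_m\in\mathbb C$ (not necessarily distinct), and let $\varkappa_0,\dots,\varkappa_m$ and $\chi_0,\dots,\chi_m$ be nonnegative integers. Let $V\in\mathbb C^{n\times\hat n}$, $\hat n\ge1$, satisfy $V^HV=\mathbf 1$. Put $\Lambda=V^H$, $\widehat A=V^HAV$, $\hat b=V^Hb$, $\hat d=V^Hd$, and assume that no $\lambda_k$ ($1\le k\le m$) is an eigenvalue of $A$ or of $\widehat A$. Suppose that the vectors $$A^{j}b\ (0\le j<\varkappa_0),\qquad (\lambda_k\mathbf 1-A)^{-j}b\ (1\le k\le m,\ 1\le j\le\varkappa_k),$$ $$(A^H)^{j}d\ (0\le j<\chi_0),\qquad (\bar\lambda_k\mathbf 1-A^H)^{-j}d\ (1\le k\le m,\ 1\le j\le\chi_k),$$ taken together as one family, are linearly independent and form a basis of the image of $V$. Let $\hat\mu_1,\dots,\hat\mu_{\hat m}$ be the distinct eigenvalues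 of $\widehat A$, with algebraic multiplicities $\hat w_1,\dots,\hat w_{\hat m}$, and put $$v(\lambda)=\prod_{k=1}^m(\lambda-\lambda_k)^{\varkappa_k+\chi_k},\qquad \Omega(\lambda)=\prod_{k=1}^{\hat m}(\lambda-\hat\mu_k)^{\hat w_k},\qquad \exp_t(\lambda)=e^{\lambda t}.$$ Then $$\bigl|d^He^{tA}b-\hat d^He^{t\widehat A}\hat b\bigr|\le\max_{\substack{s\in[0,1]\\ \mu\in\operatorname{co}\{\hat\mu_1,\dots,\hat\mu_{\hat m}\}}}\Bigl|d^H\Bigl[\Omega(A)\,v(A)^{-1}\,\frac{(v\exp_t)^{(\hat n)}\bigl((1-s)\mu\mathbf 1+sA\bigr)}{\hat n!}\Bigr]b\Bigr|,$$ and the maximum is attained. Here $\operatorname{co}$ denotes the convex hull, $^{(\hat n)}$ the $\hat n$-th derivative in $\lambda$, and an entire function $f$ is applied to a matrix $B$ by $f(B)=\frac1{2\pi i}\oint_\Gamma f(\lambda)(\lambda\mathbf 1-B)^{-1}\,d\lambda$, with $\Gamma$ a contour enclosing the spectrum of $B$. -/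

import Mathlib

open scoped Matrix BigOperators

noncomputable section

/-- A radius that exceeds the modulus of every eigenvalue of `A`. -/
def enclosingRadius {N : ℕ} (A : Matrix (Fin N) (Fin N) ℂ) : ℝ :=
  1 + ∑ i, ∑ j, ‖A i j‖

/-- The circle about `0` of radius `enclosingRadius A` encloses the spectrum of `A`. -/
theorem norm_lt_enclosingRadius {N : ℕ} (A : Matrix (Fin N) (Fin N) ℂ) {z : ℂ}
    (hz : z ∈ spectrum ℂ A) : ‖z‖ < enclosingRadius A := by
  rw [← Matrix.spectrum_toLin', ← Module.End.hasEigenvalue_iff_mem_spectrum] at hz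
  obtain ⟨k, hk⟩ := eigenvalue_mem_ball hz
  rw [mem_closedBall_iff_norm] at hk
  have h1 : ‖z‖ ≤ ‖A k k‖ + ∑ j ∈ Finset.univ.erase k, ‖A k j‖ := by
    have := norm_add_le (z - A k k) (A k k)
    rw [sub_add_cancel] at this
    linarith
  rw [Finset.add_sum_erase _ (fun j => ‖A k j‖) (Finset.mem_univ k)] at h1
  have h2 : ∑ j, ‖A k j‖ ≤ ∑ i, ∑ j, ‖A i j‖ :=
    Finset.single_le_sum (f := fun i => ∑ j, ‖A i j‖)
      (fun i _ => Finset.sum_nonneg fun j _ => norm_nonneg _) (Finset.mem_univ k)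
  unfold enclosingRadius
  linarith

/-- An entire function `f` applied to a matrix `A`:
`f(A) = (2πi)⁻¹ ∮_Γ f(z) (z1 - A)⁻¹ dz` (entrywise), where the contour `Γ` is a circle that
encloses the spectrum of `A`. For entire `f` the value does not depend on the contour. -/
def entireMatrixFunction {N : ℕ} (f : ℂ → ℂ) (A : Matrix (Fin N) (Fin N) ℂ) :
    Matrix (Fin N) (Fin N) ℂ :=
  Matrix.of fun i j =>
    (2 * (Real.pi : ℂ) * Complex.I)⁻¹ *
      ∮ z in C(0, enclosingRadius A),
        f z * ((z • (1 : Matrix (Fin N) (Fin N) ℂ) - A)⁻¹ : Matrix (Fin N) (Fin N) ℂ) i j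

/-- The scalar impulse response `dᴴ e^{tA} b` of the system `x' = Ax + bu`, `y = dᴴx`. -/
def impulseResponse {N : ℕ} (A : Matrix (Fin N) (Fin N) ℂ) (b d : Fin N → ℂ) (t : ℝ) : ℂ :=
  star d ⬝ᵥ (NormedSpace.exp ((t : ℂ) • A) *ᵥ b)

/-- The matrix `Λ A V` of the reduced-order system, with `Λ = Vᴴ`. -/
def reducedMatrix {n nhat : ℕ} (V : Matrix (Fin n) (Fin nhat) ℂ)
    (A : Matrix (Fin n) (Fin n) ℂ) : Matrix (Fin nhat) (Fin nhat) ℂ :=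
  Vᴴ * A * V

/-- The vectors `Vᴴ b` and `Vᴴ d` of the reduced-order system. -/
def reducedVector {n nhat : ℕ} (V : Matrix (Fin n) (Fin nhat) ℂ) (b : Fin n → ℂ) :
    Fin nhat → ℂ :=
  Vᴴ *ᵥ b

/-- The rational Krylov vectors of `A` and `b` with poles at `∞` (multiplicity `κ₀`) and at the
points `lam k` (multiplicity `κ k`): `b, A b, …, A^(κ₀-1) b`, and
`(lam k - A)⁻¹ b, …, (lam k - A)^(-κ k) b` for each `k`. -/
def krylovVectors {n m : ℕ} (A : Matrix (Fin n) (Fin n) ℂ) (b : Fin n → ℂ)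
    (lam : Fin m → ℂ) (κ₀ : ℕ) (κ : Fin m → ℕ) :
    Fin κ₀ ⊕ (Σ k : Fin m, Fin (κ k)) → (Fin n → ℂ) :=
  Sum.elim
    (fun j => A ^ (j : ℕ) *ᵥ b)
    (fun p => ((lam p.1 • (1 : Matrix (Fin n) (Fin n) ℂ) - A)⁻¹) ^ ((p.2 : ℕ) + 1) *ᵥ b)

/-- All the vectors of the two-sided method: the rational Krylov vectors of `A`, `b` with poles
`lam k`, followed by those of `Aᴴ`, `d` with the conjugate poles. -/
def twoSidedKrylovVectors {n m : ℕ} (A : Matrix (Fin n) (Fin n) ℂ) (b d : Fin n → ℂ)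
    (lam : Fin m → ℂ) (κ₀ χ₀ : ℕ) (κ χ : Fin m → ℕ) :
    (Fin κ₀ ⊕ (Σ k : Fin m, Fin (κ k))) ⊕ (Fin χ₀ ⊕ (Σ k : Fin m, Fin (χ k))) →
      (Fin n → ℂ) :=
  Sum.elim (krylovVectors A b lam κ₀ κ)
    (krylovVectors Aᴴ d (fun k => star (lam k)) χ₀ χ)

/-- `v(z) = ∏ₖ (z - lam k)^(κ k + χ k)`. -/
def polePoly {m : ℕ} (lam : Fin m → ℂ) (κ χ : Fin m → ℕ) : Polynomial ℂ :=
  ∏ k, (Polynomial.X - Polynomial.C (lam k)) ^ (κ k + χ k)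

/-- `Ω(z) = ∏ₖ (z - μ k)^(w k)`. -/
def nodePoly {mhat : ℕ} (μ : Fin mhat → ℂ) (w : Fin mhat → ℕ) : Polynomial ℂ :=
  ∏ k, (Polynomial.X - Polynomial.C (μ k)) ^ w k

/-- The quantity
`|dᴴ [Ω(A) v(A)⁻¹ (v exp_t)^(N)((1-s)μ1 + sA) / N!] b|`. -/
def errorTerm {n : ℕ} (A : Matrix (Fin n) (Fin n) ℂ) (b d : Fin n → ℂ)
    (Ω v : Polynomial ℂ) (N : ℕ) (t s : ℝ) (μ : ℂ) : ℝ :=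
  ‖star d ⬝ᵥ
    ((Polynomial.aeval A Ω * (Polynomial.aeval A v)⁻¹ *
      ((N.factorial : ℂ)⁻¹ •
        entireMatrixFunction
          (iteratedDeriv N fun z : ℂ => v.eval z * Complex.exp (z * (t : ℂ)))
          (((1 - (s : ℂ)) * μ) • (1 : Matrix (Fin n) (Fin n) ℂ) + (s : ℂ) • A))) *ᵥ b)‖

end

/-!
A function `f` is applied to an element of a Banach algebra through its Taylor series. Write
`f(a)` as the endpoint of the segment from a scalar `μ` to `a`: the fundamental theorem of calculus
gives `f(a) = f(μ) + (a - μ) ∫₀¹ f'((1 - s) μ + s a) ds`. Iterating over the list of nodes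
`μ₁, …, μ_N` writes a functional of `f(a)` that kills all powers `a ^ j` with `j < N` as an
iterated integral of `∏ (a - μᵢ) f⁽ᴺ⁾`, whence the factor `1 / N!`.

This is applied in the product of the two matrix algebras to the pair of `A` and its reduction,
with `v f` in place of `f` and the functional `(X, Y) ↦ dᴴ v(A)⁻¹ X b - d̂ᴴ v(Â)⁻¹ Y b̂`. It kills
the required powers because two-sided rational Krylov projection matches moments, and by
Cayley–Hamilton the node polynomial vanishes on the reduced matrix when the nodes are its
eigenvalues, so only the term in `A` remains.
-/

open Polynomial

open scoped Pointwise

section EntireEval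

theorem norm_pow_le_pow_norm_mul_norm_one {𝒜 : Type*} [NormedRing 𝒜] (x : 𝒜) (k : ℕ) :
    ‖x ^ k‖ ≤ ‖x‖ ^ k * ‖(1 : 𝒜)‖ := by
  induction k with
  | zero => simp
  | succ k ih =>
    calc ‖x ^ (k + 1)‖ ≤ ‖x‖ * ‖x ^ k‖ := by rw [pow_succ']; exact norm_mul_le _ _
      _ ≤ ‖x‖ * (‖x‖ ^ k * ‖(1 : 𝒜)‖) := by gcongr
      _ = ‖x‖ ^ (k + 1) * ‖(1 : 𝒜)‖ := by ring

variable {𝒜 ℬ : Type*} [NormedRing 𝒜] [NormedAlgebra ℂ 𝒜] [NormedRing ℬ] [NormedAlgebra ℂ ℬ]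

theorem hasDerivAt_add_smul_pow_succ {x y : 𝒜} (h : Commute x y) (k : ℕ) (z : ℂ) :
    HasDerivAt (fun z : ℂ => (x + z • y) ^ (k + 1)) ((k + 1 : ℂ) • (y * (x + z • y) ^ k)) z := by
  have hlin : HasDerivAt (fun z : ℂ => x + z • y) y z := by
    simpa using ((hasDerivAt_id z).smul_const y).const_add x
  have hcomm : Commute (x + z • y) y := h.add_left ((Commute.refl y).smul_left z)
  refine (hlin.fun_pow' (k + 1)).congr_deriv ?_
  have hterm : ∀ i ∈ Finset.range (k + 1), (x + z • y) ^ (k - i) * y * (x + z • y) ^ i =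
      y * (x + z • y) ^ k := fun i hi => by
    rw [(hcomm.pow_left _).eq, mul_assoc, ← pow_add,
      Nat.sub_add_cancel (Nat.lt_succ_iff.1 (Finset.mem_range.1 hi))]
  rw [Nat.pred_succ, Finset.sum_congr rfl hterm, Finset.sum_const, Finset.card_range,
    ← Nat.cast_smul_eq_nsmul ℂ, Nat.cast_add_one]

/-- The `k`-th Taylor coefficient of `f` at the origin. -/
noncomputable def taylorCoeff (f : ℂ → ℂ) (k : ℕ) : ℂ :=
  (k.factorial : ℂ)⁻¹ * iteratedDeriv k f 0

/-- The entire function `f` evaluated at an element of a Banach algebra, through its Taylor series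
at the origin. -/
noncomputable def entireEval (f : ℂ → ℂ) (x : 𝒜) : 𝒜 :=
  ∑' k, taylorCoeff f k • x ^ k

variable {f g : ℂ → ℂ}

theorem summable_norm_taylorCoeff_mul_pow (hf : Differentiable ℂ f) (r : ℝ) :
    Summable fun k => ‖taylorCoeff f k‖ * |r| ^ k := by
  refine (Complex.hasSum_taylorSeries_of_entire hf 0 r).summable.norm.congr fun k => ?_
  rw [sub_zero, smul_smul, smul_eq_mul, mul_right_comm, norm_mul, norm_pow, Complex.norm_real,
    Real.norm_eq_abs, taylorCoeff]

theorem succ_mul_taylorCoeff_succ (f : ℂ → ℂ) (k : ℕ) :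
    (k + 1 : ℂ) * taylorCoeff f (k + 1) = taylorCoeff (deriv f) k := by
  have : (k + 1 : ℂ) ≠ 0 := Nat.cast_add_one_ne_zero k
  have : (k.factorial : ℂ) ≠ 0 := Nat.cast_ne_zero.2 k.factorial_ne_zero
  rw [taylorCoeff, taylorCoeff, iteratedDeriv_succ', Nat.factorial_succ]
  push_cast
  field_simp

theorem norm_taylorCoeff_smul_pow_le {x : 𝒜} {r : ℝ} (hx : ‖x‖ ≤ r) (k : ℕ) :
    ‖taylorCoeff f k • x ^ k‖ ≤ ‖taylorCoeff f k‖ * |r| ^ k * ‖(1 : 𝒜)‖ := by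
  have hr : ‖x‖ ≤ |r| := hx.trans (le_abs_self r)
  calc ‖taylorCoeff f k • x ^ k‖ ≤ ‖taylorCoeff f k‖ * (‖x‖ ^ k * ‖(1 : 𝒜)‖) :=
        (norm_smul_le _ _).trans (by gcongr; exact norm_pow_le_pow_norm_mul_norm_one x k)
    _ ≤ ‖taylorCoeff f k‖ * |r| ^ k * ‖(1 : 𝒜)‖ := by rw [← mul_assoc]; gcongr

theorem summable_norm_taylorCoeff_smul_pow (hf : Differentiable ℂ f) (x : 𝒜) :
    Summable fun k => ‖taylorCoeff f k • x ^ k‖ :=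
  .of_nonneg_of_le (fun _ => norm_nonneg _) (norm_taylorCoeff_smul_pow_le le_rfl)
    ((summable_norm_taylorCoeff_mul_pow hf ‖x‖).mul_right _)

theorem entireEval_aeval (p : ℂ[X]) (x : 𝒜) : entireEval (fun z => p.eval z) x = aeval x p := by
  have hcoeff : ∀ k, taylorCoeff (fun z => p.eval z) k = p.coeff k := fun k => by
    have h : iteratedDeriv k (fun z => p.eval z) = fun z => (derivative^[k] p).eval z := by
      rw [iteratedDeriv_eq_iterate]
      induction k with
      | zero => rfl
      | succ k ih =>
        rw [Function.iterate_succ_apply', ih, Function.iterate_succ_apply']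
        exact funext fun z => Polynomial.deriv _
    have : (k.factorial : ℂ) ≠ 0 := Nat.cast_ne_zero.2 k.factorial_ne_zero
    rw [taylorCoeff, congrFun h, ← coeff_zero_eq_eval_zero, coeff_iterate_derivative, zero_add,
      Nat.descFactorial_self, nsmul_eq_mul, inv_mul_cancel_left₀ this]
  rw [entireEval, aeval_eq_sum_range]
  simp only [hcoeff]
  exact tsum_eq_sum fun k hk => by
    rw [coeff_eq_zero_of_natDegree_lt (by simpa [Nat.lt_succ_iff] using hk), zero_smul]

theorem entireEval_cexp_mul (t : ℂ) (x : 𝒜) :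
    entireEval (fun z => Complex.exp (z * t)) x = NormedSpace.exp (t • x) := by
  rw [entireEval, NormedSpace.exp_eq_tsum ℂ]
  refine tsum_congr fun k => ?_
  simp only [taylorCoeff, mul_comm _ t, iteratedDeriv_cexp_const_mul, mul_zero, Complex.exp_zero,
    mul_one, _root_.smul_pow, smul_smul]

variable [CompleteSpace 𝒜] [CompleteSpace ℬ]

theorem hasSum_entireEval (hf : Differentiable ℂ f) (x : 𝒜) :
    HasSum (fun k => taylorCoeff f k • x ^ k) (entireEval f x) :=
  (summable_norm_taylorCoeff_smul_pow hf x).of_norm.hasSum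

theorem continuous_entireEval (hf : Differentiable ℂ f) :
    Continuous (entireEval f : 𝒜 → 𝒜) := by
  refine continuous_iff_continuousAt.2 fun x => ?_
  have hcont : ContinuousOn (entireEval f : 𝒜 → 𝒜) (Metric.ball 0 (‖x‖ + 1)) :=
    continuousOn_tsum (fun k => by fun_prop)
      ((summable_norm_taylorCoeff_mul_pow hf (‖x‖ + 1)).mul_right ‖(1 : 𝒜)‖)
      fun k y hy => norm_taylorCoeff_smul_pow_le (mem_ball_zero_iff.1 hy).le k
  exact hcont.continuousAt (Metric.isOpen_ball.mem_nhds (by simp))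

theorem map_entireEval (hf : Differentiable ℂ f) (φ : 𝒜 →ₐ[ℂ] ℬ) (hφ : Continuous φ) (x : 𝒜) :
    φ (entireEval f x) = entireEval f (φ x) := by
  refine HasSum.unique ?_ (hasSum_entireEval hf (φ x))
  simpa only [Function.comp_def, map_smul, map_pow] using (hasSum_entireEval hf x).map φ hφ

theorem entireEval_algebraMap (hf : Differentiable ℂ f) (c : ℂ) :
    entireEval f (algebraMap ℂ 𝒜 c) = algebraMap ℂ 𝒜 (entireEval f c) :=
  (map_entireEval hf (Algebra.ofId ℂ 𝒜) (algebraMapCLM ℂ 𝒜).continuous c).symm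

theorem entireEval_mul (hf : Differentiable ℂ f) (hg : Differentiable ℂ g) (x : 𝒜) :
    entireEval (fun z => f z * g z) x = entireEval f x * entireEval g x := by
  rw [entireEval, entireEval, entireEval, tsum_mul_tsum_eq_tsum_sum_antidiagonal_of_summable_norm
    (summable_norm_taylorCoeff_smul_pow hf x) (summable_norm_taylorCoeff_smul_pow hg x)]
  refine tsum_congr fun k => ?_
  have hcoeff : taylorCoeff (fun z => f z * g z) k =
      ∑ p ∈ Finset.HasAntidiagonal.antidiagonal k, taylorCoeff f p.1 * taylorCoeff g p.2 := by
    rw [taylorCoeff, iteratedDeriv_fun_mul hf.contDiff.contDiffAt hg.contDiff.contDiffAt,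
      Finset.Nat.sum_antidiagonal_eq_sum_range_succ fun i j => taylorCoeff f i * taylorCoeff g j,
      Finset.mul_sum]
    refine Finset.sum_congr rfl fun i hi => ?_
    have hik : i ≤ k := Nat.lt_succ_iff.1 (Finset.mem_range.1 hi)
    rw [Nat.cast_choose ℂ hik, taylorCoeff, taylorCoeff]
    have : (k.factorial : ℂ) ≠ 0 := Nat.cast_ne_zero.2 k.factorial_ne_zero
    field_simp
  rw [hcoeff, Finset.sum_smul]
  refine Finset.sum_congr rfl fun p hp => ?_
  rw [smul_mul_smul_comm, ← pow_add, Finset.HasAntidiagonal.mem_antidiagonal.1 hp]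

theorem hasDerivAt_entireEval_add_smul (hf : Differentiable ℂ f) {x y : 𝒜} (h : Commute x y)
    (z : ℂ) :
    HasDerivAt (fun z : ℂ => entireEval f (x + z • y))
      (y * entireEval (deriv f) (x + z • y)) z := by
  have hsplit : ∀ x : 𝒜, entireEval f x =
      taylorCoeff f 0 • 1 + ∑' k, taylorCoeff f (k + 1) • x ^ (k + 1) := fun x => by
    rw [entireEval, (hasSum_entireEval hf x).summable.tsum_eq_zero_add, pow_zero]
  have hbound : ∀ k, ∀ w ∈ Metric.ball (0 : ℂ) (‖z‖ + 1),
      ‖taylorCoeff (deriv f) k • (y * (x + w • y) ^ k)‖ ≤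
        ‖y‖ * (‖taylorCoeff (deriv f) k‖ * |‖x‖ + (‖z‖ + 1) * ‖y‖| ^ k * ‖(1 : 𝒜)‖) := by
    intro k w hw
    have hw' : ‖x + w • y‖ ≤ ‖x‖ + (‖z‖ + 1) * ‖y‖ := by
      refine (norm_add_le _ _).trans ?_
      rw [norm_smul]
      gcongr
      exact (mem_ball_zero_iff.1 hw).le
    rw [← mul_smul_comm]
    exact (norm_mul_le _ _).trans (by gcongr; exact norm_taylorCoeff_smul_pow_le hw' k)
  have hterm : ∀ k w, HasDerivAt (fun w : ℂ => taylorCoeff f (k + 1) • (x + w • y) ^ (k + 1))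
      (taylorCoeff (deriv f) k • (y * (x + w • y) ^ k)) w := fun k w => by
    refine ((hasDerivAt_add_smul_pow_succ h k w).const_smul (taylorCoeff f (k + 1))).congr_deriv ?_
    rw [smul_smul, mul_comm, succ_mul_taylorCoeff_succ]
  have hsum := (summable_nat_add_iff 1).2 (hasSum_entireEval hf (x + (0 : ℂ) • y)).summable
  have htsum := hasDerivAt_tsum_of_isPreconnected
    (((summable_norm_taylorCoeff_mul_pow hf.deriv _).mul_right _).mul_left ‖y‖)
    Metric.isOpen_ball (convex_ball 0 (‖z‖ + 1)).isPreconnected (fun k w _ => hterm k w) hbound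
    (Metric.mem_ball_self (by positivity)) hsum (y := z) (by simp)
  simp only [hsplit]
  refine (htsum.const_add (taylorCoeff f 0 • 1)).congr_deriv ?_
  simp only [← mul_smul_comm]
  exact (hasSum_entireEval hf.deriv _).summable.tsum_mul_left y

end EntireEval

section HermiteInterpolation

theorem norm_le_mul_pow_succ_div_factorial {E : Type*} [NormedAddCommGroup E] [NormedSpace ℝ E]
    {u u' : ℝ → E} {M r : ℝ} {k : ℕ} (hr : 0 ≤ r) (hu0 : u 0 = 0)
    (hu : ∀ s, HasDerivAt u (u' s) s)
    (hbound : ∀ s ∈ Set.Ico 0 r, ‖u' s‖ ≤ M * s ^ k / k.factorial) :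
    ‖u r‖ ≤ M * r ^ (k + 1) / (k + 1).factorial := by
  have hB : ∀ s : ℝ, HasDerivAt (fun s => M * s ^ (k + 1) / (k + 1).factorial)
      (M * s ^ k / k.factorial) s := fun s => by
    refine (((hasDerivAt_pow (k + 1) s).const_mul M).div_const _).congr_deriv ?_
    rw [Nat.factorial_succ, Nat.add_sub_cancel]
    push_cast
    field_simp
  exact image_norm_le_of_norm_deriv_right_le_deriv_boundary
    (fun s _ => (hu s).continuousAt.continuousWithinAt) (fun s _ => (hu s).hasDerivWithinAt)
    (by simp [hu0]) hB hbound ⟨hr, le_rfl⟩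

variable {𝒜 ℬ E : Type*} [NormedRing 𝒜] [NormedAlgebra ℂ 𝒜] [CompleteSpace 𝒜]
  [NormedRing ℬ] [NormedAlgebra ℂ ℬ] [CompleteSpace ℬ] [NormedAddCommGroup E] [NormedSpace ℂ E]

theorem hasDerivAt_apply_entireEval_add_smul {f : ℂ → ℂ} (hf : Differentiable ℂ f)
    (Ψ : 𝒜 →L[ℂ] E) {x y : 𝒜} (h : Commute x y) (s : ℝ) :
    HasDerivAt (fun s : ℝ => Ψ (entireEval f (x + (s : ℂ) • y)))
      (Ψ (y * entireEval (deriv f) (x + (s : ℂ) • y))) s := by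
  simpa [Function.comp_def] using (Ψ.hasFDerivAt.comp_hasDerivAt (s : ℂ)
    (hasDerivAt_entireEval_add_smul hf h s)).scomp s Complex.ofRealCLM.hasDerivAt

-- The value at `c + r a` is reached from the scalar `c + r μ` along `s ↦ c + (r - s) μ + s a`.
-- Its derivative in `s` contains the factor `a - μ`, which removes the node `μ` from `Ψ`.
theorem norm_apply_entireEval_le {K : Set ℂ} (hK : Convex ℝ K) {M : ℝ} (a : 𝒜) (l : List ℂ)
    (hl : ∀ μ ∈ l, μ ∈ K) (Ψ : 𝒜 →L[ℂ] E) (hΨ : ∀ j < l.length, Ψ (a ^ j) = 0)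
    {f : ℂ → ℂ} (hf : Differentiable ℂ f)
    (hM : ∀ s ∈ Set.Icc (0 : ℝ) 1, ∀ c ∈ (1 - s) • K,
      ‖Ψ (aeval a (l.map fun μ => X - C μ).prod *
        entireEval (iteratedDeriv l.length f) (algebraMap ℂ 𝒜 c + (s : ℂ) • a))‖ ≤ M)
    {r : ℝ} (hr : r ∈ Set.Icc (0 : ℝ) 1) {c : ℂ} (hc : c ∈ (1 - r) • K) :
    ‖Ψ (entireEval f (algebraMap ℂ 𝒜 c + (r : ℂ) • a))‖ ≤
      M * r ^ l.length / l.length.factorial := by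
  induction l generalizing Ψ f r c with
  | nil => simpa using hM r hr c hc
  | cons μ l ih =>
    set y := a - algebraMap ℂ 𝒜 μ with hy
    let Ψ' : 𝒜 →L[ℂ] E := Ψ.comp (ContinuousLinearMap.mul ℂ 𝒜 y)
    have hΨ'_apply : ∀ x, Ψ' x = Ψ (y * x) := fun _ => rfl
    have hΨ' : ∀ j < l.length, Ψ' (a ^ j) = 0 := fun j hj => by
      rw [hΨ'_apply, hy, sub_mul, ← pow_succ', ← Algebra.smul_def, map_sub, map_smul,
        hΨ _ (Nat.succ_lt_succ hj), hΨ _ (hj.trans (Nat.lt_succ_self _)), smul_zero, sub_zero]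
    have hderiv_le := fun {s} hs {c} hc =>
      ih (fun ν hν => hl ν (List.mem_cons_of_mem _ hν)) Ψ' hΨ' hf.deriv (r := s) (c := c)
        (hr := hs) (hc := hc) fun s hs c hc => by
        simpa only [List.map_cons, List.prod_cons, map_mul, map_sub, aeval_X, aeval_C, ← hy,
          mul_assoc, ← hΨ'_apply, List.length_cons, iteratedDeriv_succ'] using hM s hs c hc
    have hpath : ∀ s : ℝ, algebraMap ℂ 𝒜 (c + r * μ) + (s : ℂ) • y =
        algebraMap ℂ 𝒜 (c + (r - s) * μ) + (s : ℂ) • a := fun s => by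
      simp only [hy, Algebra.algebraMap_eq_smul_one]
      module
    have hstart : Ψ (entireEval f (algebraMap ℂ 𝒜 (c + r * μ) + ((0 : ℝ) : ℂ) • y)) = 0 := by
      rw [Complex.ofReal_zero, zero_smul, add_zero, entireEval_algebraMap hf,
        Algebra.algebraMap_eq_smul_one, map_smul, ← pow_zero a, hΨ 0 (Nat.succ_pos _), smul_zero]
    have hfin := norm_le_mul_pow_succ_div_factorial hr.1 hstart
      (hasDerivAt_apply_entireEval_add_smul hf Ψ (Algebra.commute_algebraMap_left _ y))
      fun s hs => by
      have hmem : c + (r - s) * μ ∈ (1 - s) • K := by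
        rw [show 1 - s = (1 - r) + (r - s) by ring,
          hK.add_smul (sub_nonneg.2 hr.2) (sub_nonneg.2 hs.2.le)]
        exact Set.add_mem_add hc ⟨μ, hl μ List.mem_cons_self, by simp⟩
      rw [hpath]
      exact hderiv_le ⟨hs.1, hs.2.le.trans hr.2⟩ hmem
    simpa only [hpath, sub_self, zero_mul, add_zero, List.length_cons] using hfin

theorem norm_apply_entireEval_sub_le {K : Set ℂ} (hK : Convex ℝ K) (hK₀ : K.Nonempty) {M : ℝ}
    {a : 𝒜} {b : ℬ} {φ : 𝒜 →L[ℂ] E} {ψ : ℬ →L[ℂ] E} {l : List ℂ} (hl : ∀ μ ∈ l, μ ∈ K)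
    (hb : aeval b (l.map fun μ => X - C μ).prod = 0)
    (hφψ : ∀ j < l.length, φ (a ^ j) = ψ (b ^ j)) {f : ℂ → ℂ} (hf : Differentiable ℂ f)
    (hM : ∀ s ∈ Set.Icc (0 : ℝ) 1, ∀ μ ∈ K,
      ‖φ (aeval a (l.map fun μ => X - C μ).prod * entireEval (iteratedDeriv l.length f)
        (algebraMap ℂ 𝒜 ((1 - s) * μ) + (s : ℂ) • a))‖ ≤ M) :
    ‖φ (entireEval f a) - ψ (entireEval f b)‖ ≤ M / l.length.factorial := by
  let Ψ : 𝒜 × ℬ →L[ℂ] E :=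
    φ.comp (ContinuousLinearMap.fst ℂ 𝒜 ℬ) - ψ.comp (ContinuousLinearMap.snd ℂ 𝒜 ℬ)
  have hfst : ∀ {g : ℂ → ℂ}, Differentiable ℂ g → ∀ x : 𝒜 × ℬ,
      (entireEval g x).1 = entireEval g x.1 := fun hg x =>
    map_entireEval hg (AlgHom.fst ℂ 𝒜 ℬ) continuous_fst x
  have hsnd : (entireEval f (a, b)).2 = entireEval f b :=
    map_entireEval hf (AlgHom.snd ℂ 𝒜 ℬ) continuous_snd (a, b)
  have hnode : ∀ s ∈ Set.Icc (0 : ℝ) 1, ∀ c ∈ (1 - s) • K,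
      ‖Ψ (aeval (a, b) (l.map fun μ => X - C μ).prod * entireEval (iteratedDeriv l.length f)
        (algebraMap ℂ (𝒜 × ℬ) c + (s : ℂ) • (a, b)))‖ ≤ M := by
    rintro s hs _ ⟨μ, hμ, rfl⟩
    have hΩ : aeval (a, b) (l.map fun μ => X - C μ).prod =
        (aeval a (l.map fun μ => X - C μ).prod, 0) := by
      rw [aeval_prod_apply, hb]
    have hderiv := hf.contDiff.differentiable_iteratedDeriv' l.length
    simpa [Ψ, hΩ, hfst hderiv] using hM s hs μ hμ
  have hzero : (0 : ℂ) ∈ (1 - (1 : ℝ)) • K := by simp [Set.zero_smul_set hK₀]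
  simpa [Ψ, hfst hf, hsnd] using norm_apply_entireEval_le hK (a, b) l hl Ψ
    (fun j hj => sub_eq_zero.2 (hφψ j hj)) hf hnode (r := 1) (by simp) hzero

end HermiteInterpolation

section ContourIntegral

theorem hasSum_circleIntegral_of_norm_le {E : Type*} [NormedAddCommGroup E] [NormedSpace ℂ E]
    {F : ℕ → ℂ → E} {f : ℂ → E} {c : ℂ} {R : ℝ} (hR : 0 ≤ R) {u : ℕ → ℝ} (hu : Summable u)
    (hF : ∀ k, ContinuousOn (F k) (Metric.sphere c R))
    (hFu : ∀ k, ∀ z ∈ Metric.sphere c R, ‖F k z‖ ≤ u k)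
    (hsum : ∀ z ∈ Metric.sphere c R, HasSum (fun k => F k z) (f z)) :
    HasSum (fun k => ∮ z in C(c, R), F k z) (∮ z in C(c, R), f z) := by
  have hmem : ∀ θ, circleMap c R θ ∈ Metric.sphere c R := circleMap_mem_sphere c hR
  refine intervalIntegral.hasSum_integral_of_dominated_convergence
    (fun k _ => R * u k) (fun k => ?_) (fun k => ?_) ?_ intervalIntegrable_const ?_
  · have hcomp : Continuous fun θ => F k (circleMap c R θ) :=
      (hF k).comp_continuous (continuous_circleMap c R) hmem
    simp only [deriv_circleMap]
    exact (((continuous_circleMap 0 R).mul continuous_const).smul hcomp).aestronglyMeasurable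
  · refine Filter.Eventually.of_forall fun θ _ => ?_
    simpa [norm_smul, abs_of_nonneg hR] using mul_le_mul_of_nonneg_left (hFu k _ (hmem θ)) hR
  · exact Filter.Eventually.of_forall fun _ _ => hu.mul_left R
  · exact Filter.Eventually.of_forall fun θ _ => (hsum _ (hmem θ)).const_smul _

section Resolvent

variable {𝒜 E : Type*} [NormedRing 𝒜] [NormedAlgebra ℂ 𝒜]
  [NormedAddCommGroup E] [NormedSpace ℂ E] {a : 𝒜} {z : ℂ}

theorem norm_smul_apply_pow_le (φ : 𝒜 →L[ℂ] E) {w : ℂ} {R C : ℝ} (hz : ‖z‖ = R) (hR : 0 < R)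
    (hw : ‖w‖ ≤ C) (k : ℕ) :
    ‖(1 / z ^ (k + 1) * w) • φ (a ^ k)‖ ≤ C * R⁻¹ * (‖φ‖ * ‖(1 : 𝒜)‖) * (‖a‖ / R) ^ k := by
  have hC : 0 ≤ C := (norm_nonneg _).trans hw
  have hφ : ‖φ (a ^ k)‖ ≤ ‖φ‖ * (‖a‖ ^ k * ‖(1 : 𝒜)‖) :=
    (φ.le_opNorm _).trans (by gcongr; exact norm_pow_le_pow_norm_mul_norm_one a k)
  rw [norm_smul, norm_mul, norm_div, norm_one, norm_pow, hz]
  calc 1 / R ^ (k + 1) * ‖w‖ * ‖φ (a ^ k)‖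
      ≤ 1 / R ^ (k + 1) * C * (‖φ‖ * (‖a‖ ^ k * ‖(1 : 𝒜)‖)) := by gcongr
    _ = C * R⁻¹ * (‖φ‖ * ‖(1 : 𝒜)‖) * (‖a‖ / R) ^ k := by rw [div_pow]; field_simp; ring

variable [CompleteSpace 𝒜]

theorem hasSum_resolvent (h : ‖a‖ < ‖z‖) :
    HasSum (fun k => (1 / z ^ (k + 1)) • a ^ k) (resolvent a z) := by
  have hz : z ≠ 0 := norm_pos_iff.1 ((norm_nonneg a).trans_lt h)
  have hlt : ‖z⁻¹ • a‖ < 1 := by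
    rwa [norm_smul, norm_inv, inv_mul_lt_one₀ ((norm_nonneg a).trans_lt h)]
  have hres : resolvent a z = z⁻¹ • Ring.inverse (1 - z⁻¹ • a) := by
    have := spectrum.units_smul_resolvent_self (r := Units.mk0 z hz) (a := a)
    rw [eq_inv_smul_iff₀ hz]
    simpa [resolvent, Units.smul_def] using this
  rw [hres]
  convert! (hasSum_geom_series_inverse _ hlt).const_smul z⁻¹ using 2 with k
  rw [_root_.smul_pow, smul_smul, one_div, inv_pow, ← mul_inv, pow_succ']

theorem circleIntegral_smul_apply_resolvent [CompleteSpace E] {f : ℂ → ℂ}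
    (hf : Differentiable ℂ f) {R : ℝ} (ha : ‖a‖ < R) (φ : 𝒜 →L[ℂ] E) :
    (∮ z in C(0, R), f z • φ (resolvent a z)) =
      (2 * Real.pi * Complex.I : ℂ) • φ (entireEval f a) := by
  have hR : 0 < R := (norm_nonneg a).trans_lt ha
  obtain ⟨C, hC⟩ := (isCompact_sphere (0 : ℂ) R).exists_bound_of_continuousOn
    hf.continuous.continuousOn
  have hterm : ∀ k, (∮ z in C(0, R), (1 / (z - 0) ^ (k + 1) * f z) • φ (a ^ k)) =
      (2 * Real.pi * Complex.I : ℂ) • φ (taylorCoeff f k • a ^ k) := fun k => by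
    have hcauchy := hf.diffContOnCl.circleIntegral_one_div_sub_center_pow_smul (c := 0) hR k
    simp only [smul_eq_mul] at hcauchy
    rw [circleIntegral.integral_smul_const, hcauchy, map_smul, smul_smul, taylorCoeff,
      div_eq_mul_inv, mul_assoc]
  have hsum := hasSum_circleIntegral_of_norm_le (E := E) (c := 0) hR.le
    (F := fun k z => (1 / (z - 0) ^ (k + 1) * f z) • φ (a ^ k))
    (f := fun z => f z • φ (resolvent a z))
    (u := fun k => C * R⁻¹ * (‖φ‖ * ‖(1 : 𝒜)‖) * (‖a‖ / R) ^ k) ?_ ?_ ?_ ?_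
  · simp only [hterm] at hsum
    exact hsum.unique (((hasSum_entireEval hf a).mapL φ).const_smul _)
  · exact (summable_geometric_of_lt_one (by positivity) ((div_lt_one hR).2 ha)).mul_left _
  · refine fun k => (ContinuousOn.mul (fun z hz => ?_) hf.continuous.continuousOn).smul
      continuousOn_const
    have hz : z ≠ 0 := ne_zero_of_mem_sphere hR.ne' ⟨z, hz⟩
    exact ContinuousAt.continuousWithinAt (by fun_prop (disch := simpa using hz))
  · intro k z hz
    rw [sub_zero]
    exact norm_smul_apply_pow_le φ (mem_sphere_zero_iff_norm.1 hz) hR (hC z hz) k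
  · intro z hz
    rw [← mem_sphere_zero_iff_norm.1 hz] at ha
    simpa only [Function.comp_def, map_smul, smul_smul, sub_zero, mul_comm (f z)] using
      ((hasSum_resolvent ha).mapL φ).const_smul (f z)

end Resolvent

section MatrixNorm

open scoped Matrix.Norms.Operator

theorem linfty_opNorm_lt_enclosingRadius {N : ℕ} (B : Matrix (Fin N) (Fin N) ℂ) :
    ‖B‖ < enclosingRadius B := by
  refine lt_of_le_of_lt ?_ (lt_one_add _)
  rw [Matrix.linfty_opNorm_def]
  have hsup : (Finset.univ.sup fun i => ∑ j, ‖B i j‖₊) ≤ ∑ i, ∑ j, ‖B i j‖₊ :=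
    Finset.sup_le fun i _ => Finset.single_le_sum (f := fun i => ∑ j, ‖B i j‖₊)
      (fun _ _ => zero_le) (Finset.mem_univ i)
  simpa only [NNReal.coe_sum, coe_nnnorm] using NNReal.coe_le_coe.2 hsup

theorem entireMatrixFunction_eq_entireEval {N : ℕ} {f : ℂ → ℂ} (hf : Differentiable ℂ f)
    (B : Matrix (Fin N) (Fin N) ℂ) : entireMatrixFunction f B = entireEval f B := by
  ext i j
  let entry : Matrix (Fin N) (Fin N) ℂ →L[ℂ] ℂ :=
    ⟨Matrix.entryLinearMap ℂ ℂ i j, LinearMap.continuous_of_finiteDimensional _⟩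
  have hint : (∮ z in C(0, enclosingRadius B), f z * resolvent B z i j) =
      2 * Real.pi * Complex.I * entireEval f B i j :=
    circleIntegral_smul_apply_resolvent hf (linfty_opNorm_lt_enclosingRadius B) entry
  simp only [entireMatrixFunction, Matrix.of_apply, Matrix.nonsing_inv_eq_ringInverse,
    ← Algebra.algebraMap_eq_smul_one]
  exact (congrArg _ hint).trans (inv_mul_cancel_left₀ Complex.two_pi_I_ne_zero _)

end MatrixNorm

end ContourIntegral

section RationalKrylov

variable {n m : ℕ} {ι : Type*} [Fintype ι] [DecidableEq ι]

theorem monic_nodePoly (lam : Fin m → ℂ) (κ : Fin m → ℕ) : (nodePoly lam κ).Monic :=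
  monic_prod_of_monic _ _ fun k _ => (monic_X_sub_C (lam k)).pow (κ k)

theorem natDegree_nodePoly (lam : Fin m → ℂ) (κ : Fin m → ℕ) :
    (nodePoly lam κ).natDegree = ∑ k, κ k := by
  rw [nodePoly, natDegree_prod_of_monic _ _ fun k _ => (monic_X_sub_C _).pow _]
  simp

theorem isUnit_aeval_nodePoly {𝒜 : Type*} [Ring 𝒜] [Algebra ℂ 𝒜] {a : 𝒜} {lam : Fin m → ℂ}
    (h : ∀ k, lam k ∉ spectrum ℂ a) (κ : Fin m → ℕ) : IsUnit (aeval a (nodePoly lam κ)) := by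
  refine Finset.prod_induction _ (fun p : ℂ[X] => IsUnit (aeval a p))
    (fun p q hp hq => by rw [map_mul]; exact hp.mul hq) (by simp) fun k _ => ?_
  rw [map_pow, map_sub, aeval_X, aeval_C, ← neg_sub]
  exact (spectrum.notMem_iff.1 (h k)).neg.pow _

theorem polePoly_eq_nodePoly_mul (lam : Fin m → ℂ) (κ χ : Fin m → ℕ) :
    polePoly lam κ χ = nodePoly lam κ * nodePoly lam χ := by
  simp only [polePoly, nodePoly, pow_add, Finset.prod_mul_distrib]

theorem isUnit_aeval_polePoly {𝒜 : Type*} [Ring 𝒜] [Algebra ℂ 𝒜] {a : 𝒜} {lam : Fin m → ℂ}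
    (h : ∀ k, lam k ∉ spectrum ℂ a) (κ χ : Fin m → ℕ) : IsUnit (aeval a (polePoly lam κ χ)) := by
  rw [polePoly_eq_nodePoly_mul, map_mul]
  exact (isUnit_aeval_nodePoly h κ).mul (isUnit_aeval_nodePoly h χ)

/-- The vector `q(A)⁻¹ p(A) b`, as a linear function of the numerator `p`. -/
noncomputable def ratMulVec (A : Matrix ι ι ℂ) (b : ι → ℂ) (q : ℂ[X]) : ℂ[X] →ₗ[ℂ] (ι → ℂ) where
  toFun p := ((aeval A q)⁻¹ * aeval A p) *ᵥ b
  map_add' p₁ p₂ := by rw [map_add, mul_add, Matrix.add_mulVec]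
  map_smul' c p := by rw [map_smul, mul_smul_comm, Matrix.smul_mulVec, RingHom.id_apply]

theorem ratMulVec_mul_of_isUnit {A : Matrix ι ι ℂ} (b : ι → ℂ) {q : ℂ[X]}
    (hq : IsUnit (aeval A q)) (p : ℂ[X]) : ratMulVec A b q (q * p) = aeval A p *ᵥ b := by
  refine congrArg (· *ᵥ b) ?_
  rw [map_mul, Matrix.nonsing_inv_mul_cancel_left _ _ ((Matrix.isUnit_iff_isUnit_det _).1 hq)]

theorem ratMulVec_mul_left_of_isUnit {A : Matrix ι ι ℂ} (b : ι → ℂ) {p : ℂ[X]}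
    (hp : IsUnit (aeval A p)) (q : ℂ[X]) : ratMulVec A b (p * q) p = (aeval A q)⁻¹ *ᵥ b := by
  refine congrArg (· *ᵥ b) ?_
  rw [map_mul, Matrix.mul_inv_rev,
    Matrix.nonsing_inv_mul_cancel_right _ _ ((Matrix.isUnit_iff_isUnit_det _).1 hp)]

theorem commute_nonsing_inv_left {M P : Matrix ι ι ℂ} (h : Commute M P) : Commute M⁻¹ P := by
  rw [Matrix.nonsing_inv_eq_ringInverse]
  by_cases hM : IsUnit M
  · obtain ⟨u, rfl⟩ := hM
    rw [Ring.inverse_unit]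
    exact h.units_inv_left
  · rw [Ring.inverse_non_unit _ hM]
    exact Commute.zero_left P

theorem commute_inv_aeval_aeval (A : Matrix ι ι ℂ) (q p : ℂ[X]) :
    Commute (aeval A q)⁻¹ (aeval A p) :=
  commute_nonsing_inv_left ((Commute.all q p).map (aeval A))

theorem ratMulVec_X_mul (A : Matrix ι ι ℂ) (b : ι → ℂ) (q p : ℂ[X]) :
    ratMulVec A b q (X * p) = A *ᵥ ratMulVec A b q p := by
  have hcomm : (aeval A q)⁻¹ * A = A * (aeval A q)⁻¹ := by
    simpa only [aeval_X] using (commute_inv_aeval_aeval A q X).eq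
  simp only [ratMulVec, LinearMap.coe_mk, AddHom.coe_mk, map_mul, aeval_X, ← mul_assoc, hcomm,
    Matrix.mulVec_mulVec]

theorem aeval_conjTranspose_map_conj (A : Matrix ι ι ℂ) (p : ℂ[X]) :
    aeval Aᴴ (p.map (starRingEnd ℂ)) = (aeval A p)ᴴ := by
  induction p using Polynomial.induction_on' with
  | add p q hp hq => rw [Polynomial.map_add, map_add, map_add, hp, hq, Matrix.conjTranspose_add]
  | monomial k c =>
    rw [map_monomial, aeval_monomial, aeval_monomial, ← Algebra.smul_def, ← Algebra.smul_def,
      Matrix.conjTranspose_smul, Matrix.conjTranspose_pow, starRingEnd_apply]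

theorem star_dotProduct_ratMulVec_mul (A : Matrix ι ι ℂ) (b d : ι → ℂ) (q₁ q₂ p₁ p₂ : ℂ[X]) :
    star d ⬝ᵥ ratMulVec A b (q₁ * q₂) (p₁ * p₂) =
      star (ratMulVec Aᴴ d (q₂.map (starRingEnd ℂ)) (p₁.map (starRingEnd ℂ))) ⬝ᵥ
        ratMulVec A b q₁ p₂ := by
  simp only [ratMulVec, LinearMap.coe_mk, AddHom.coe_mk, aeval_conjTranspose_map_conj,
    Matrix.star_mulVec, Matrix.conjTranspose_mul, ← Matrix.conjTranspose_nonsing_inv,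
    Matrix.conjTranspose_conjTranspose]
  rw [← Matrix.dotProduct_mulVec, Matrix.mulVec_mulVec, map_mul, Matrix.mul_inv_rev, map_mul,
    ← (commute_inv_aeval_aeval A q₂ p₁).eq]
  simp only [mul_assoc, (commute_inv_aeval_aeval A q₁ p₁).left_comm]

/-- The numerators, over the common denominator `nodePoly lam κ`, of the rational functions
`z ^ j` and `(lam k - z) ^ (-(j + 1))` that define the rational Krylov vectors. -/
noncomputable def krylovNumerator (lam : Fin m → ℂ) (κ₀ : ℕ) (κ : Fin m → ℕ) :
    Fin κ₀ ⊕ (Σ k : Fin m, Fin (κ k)) → ℂ[X] :=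
  Sum.elim
    (fun j => nodePoly lam κ * X ^ (j : ℕ))
    (fun p => (-1) ^ ((p.2 : ℕ) + 1) * (X - C (lam p.1)) ^ (κ p.1 - ((p.2 : ℕ) + 1)) *
      ∏ k ∈ Finset.univ.erase p.1, (X - C (lam k)) ^ κ k)

theorem krylovNumerator_inr_mul (lam : Fin m → ℂ) (κ₀ : ℕ) (κ : Fin m → ℕ)
    (p : Σ k : Fin m, Fin (κ k)) :
    krylovNumerator lam κ₀ κ (Sum.inr p) * (C (lam p.1) - X) ^ ((p.2 : ℕ) + 1) =
      nodePoly lam κ := by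
  have hexp : κ p.1 - ((p.2 : ℕ) + 1) + ((p.2 : ℕ) + 1) = κ p.1 := Nat.sub_add_cancel p.2.2
  have hsign : (C (lam p.1) - X : ℂ[X]) = (-1) * (X - C (lam p.1)) := by ring
  rw [krylovNumerator, Sum.elim_inr, nodePoly, ← Finset.mul_prod_erase _ _ (Finset.mem_univ p.1),
    hsign, mul_pow]
  calc _ = ((-1 : ℂ[X]) ^ ((p.2 : ℕ) + 1) * (-1) ^ ((p.2 : ℕ) + 1)) *
        ((X - C (lam p.1)) ^ (κ p.1 - ((p.2 : ℕ) + 1)) * (X - C (lam p.1)) ^ ((p.2 : ℕ) + 1)) *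
        ∏ k ∈ Finset.univ.erase p.1, (X - C (lam k)) ^ κ k := by ring
    _ = _ := by rw [← pow_add (X - C _), hexp, ← mul_pow, neg_mul_neg, one_mul, one_pow, one_mul]

theorem krylovNumerator_mem_degreeLT (lam : Fin m → ℂ) (κ₀ : ℕ) (κ : Fin m → ℕ)
    (i : Fin κ₀ ⊕ (Σ k : Fin m, Fin (κ k))) :
    krylovNumerator lam κ₀ κ i ∈ degreeLT ℂ (κ₀ + ∑ k, κ k) := by
  have hmonic := monic_nodePoly lam κ
  rw [mem_degreeLT]
  rcases i with j | p
  · rw [krylovNumerator, Sum.elim_inl, degree_mul, degree_X_pow,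
      degree_eq_natDegree hmonic.ne_zero, natDegree_nodePoly, add_comm]
    exact_mod_cast Nat.add_lt_add_right j.2 _
  · have hmul := krylovNumerator_inr_mul lam κ₀ κ p
    have hne : krylovNumerator lam κ₀ κ (Sum.inr p) ≠ 0 :=
      left_ne_zero_of_mul (hmul ▸ hmonic.ne_zero)
    have hlinear : (C (lam p.1) - X : ℂ[X]).natDegree = 1 := by
      rw [← neg_sub, natDegree_neg, natDegree_X_sub_C]
    have hdeg := congrArg natDegree hmul
    rw [natDegree_mul hne (right_ne_zero_of_mul (hmul ▸ hmonic.ne_zero)), natDegree_pow, hlinear,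
      natDegree_nodePoly] at hdeg
    rw [degree_eq_natDegree hne, Nat.cast_lt]
    omega

theorem krylovVectors_eq_ratMulVec {A : Matrix (Fin n) (Fin n) ℂ} (b : Fin n → ℂ)
    {lam : Fin m → ℂ} (hlam : ∀ k, lam k ∉ spectrum ℂ A) (κ₀ : ℕ) (κ : Fin m → ℕ) :
    krylovVectors A b lam κ₀ κ =
      ratMulVec A b (nodePoly lam κ) ∘ krylovNumerator lam κ₀ κ := by
  have hunit := isUnit_aeval_nodePoly hlam κ
  funext i
  rw [Function.comp_apply]
  rcases i with j | p
  · rw [krylovNumerator, Sum.elim_inl, ratMulVec_mul_of_isUnit b hunit, map_pow, aeval_X]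
    rfl
  · have hmul := krylovNumerator_inr_mul lam κ₀ κ p
    have hnum : IsUnit (aeval A (krylovNumerator lam κ₀ κ (Sum.inr p))) := by
      rw [Matrix.isUnit_iff_isUnit_det, ← hmul, map_mul, Matrix.det_mul] at hunit
      exact (Matrix.isUnit_iff_isUnit_det _).2 (isUnit_of_mul_isUnit_left hunit)
    conv_rhs => rw [← hmul]
    rw [ratMulVec_mul_left_of_isUnit b hnum, map_pow, map_sub, aeval_X, aeval_C,
      Algebra.algebraMap_eq_smul_one, ← Matrix.inv_pow']
    rfl

theorem span_krylovNumerator {lam : Fin m → ℂ} {κ₀ : ℕ} {κ : Fin m → ℕ}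
    (h : LinearIndependent ℂ (krylovNumerator lam κ₀ κ)) :
    Submodule.span ℂ (Set.range (krylovNumerator lam κ₀ κ)) = degreeLT ℂ (κ₀ + ∑ k, κ k) := by
  have : Module.Finite ℂ (degreeLT ℂ (κ₀ + ∑ k, κ k)) :=
    Module.Finite.equiv (degreeLTEquiv ℂ _).symm
  refine Submodule.eq_of_le_of_finrank_eq ?_ ?_
  · rw [Submodule.span_le, Set.range_subset_iff]
    exact krylovNumerator_mem_degreeLT lam κ₀ κ
  · rw [finrank_span_eq_card h, (degreeLTEquiv ℂ _).finrank_eq]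
    simp

end RationalKrylov

section MomentMatching

variable {n nhat m : ℕ} {A : Matrix (Fin n) (Fin n) ℂ} {b d : Fin n → ℂ}
  {V : Matrix (Fin n) (Fin nhat) ℂ} {lam : Fin m → ℂ} {κ₀ χ₀ : ℕ} {κ χ : Fin m → ℕ}

theorem mulVec_conjTranspose_mulVec_of_mem_range (hV : Vᴴ * V = 1) {x : Fin n → ℂ}
    (hx : x ∈ LinearMap.range V.mulVecLin) : V *ᵥ (Vᴴ *ᵥ x) = x := by
  obtain ⟨y, rfl⟩ := hx
  simp only [Matrix.mulVecLin_apply, Matrix.mulVec_mulVec, hV, Matrix.one_mulVec]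

theorem conjTranspose_mulVec_mulVec (hV : Vᴴ * V = 1) (y : Fin nhat → ℂ) :
    Vᴴ *ᵥ (V *ᵥ y) = y := by
  rw [Matrix.mulVec_mulVec, hV, Matrix.one_mulVec]

theorem resolvent_mulVec_eq_of_mem_range (hV : Vᴴ * V = 1) {z : ℂ} (hzA : z ∉ spectrum ℂ A)
    (hzR : z ∉ spectrum ℂ (reducedMatrix V A)) {x : Fin n → ℂ}
    (hx : (z • (1 : Matrix (Fin n) (Fin n) ℂ) - A)⁻¹ *ᵥ x ∈ LinearMap.range V.mulVecLin) :
    (z • (1 : Matrix (Fin n) (Fin n) ℂ) - A)⁻¹ *ᵥ x =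
      V *ᵥ ((z • (1 : Matrix (Fin nhat) (Fin nhat) ℂ) - reducedMatrix V A)⁻¹ *ᵥ (Vᴴ *ᵥ x)) := by
  rw [spectrum.notMem_iff, Algebra.algebraMap_eq_smul_one, Matrix.isUnit_iff_isUnit_det] at hzA hzR
  set P := z • (1 : Matrix (Fin n) (Fin n) ℂ) - A with hP
  set Q := z • (1 : Matrix (Fin nhat) (Fin nhat) ℂ) - reducedMatrix V A with hQ
  have hPQ : Vᴴ * P * V = Q := by
    rw [hP, hQ, reducedMatrix, Matrix.mul_sub, Matrix.sub_mul, Matrix.mul_smul, Matrix.smul_mul,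
      Matrix.mul_one, hV]
  obtain ⟨y, hy⟩ := hx
  rw [Matrix.mulVecLin_apply] at hy
  have hx : x = P *ᵥ (V *ᵥ y) := by
    rw [hy, Matrix.mulVec_mulVec, Matrix.mul_nonsing_inv _ hzA, Matrix.one_mulVec]
  have hVx : Vᴴ *ᵥ x = Q *ᵥ y := by
    rw [hx, ← hPQ]
    simp only [Matrix.mulVec_mulVec, Matrix.mul_assoc]
  rw [hVx, Matrix.mulVec_mulVec y, Matrix.nonsing_inv_mul _ hzR, Matrix.one_mulVec, hy]

theorem krylovVectors_inl_eq_mulVec_reduced (hV : Vᴴ * V = 1)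
    (hmem : ∀ i, krylovVectors A b lam κ₀ κ i ∈ LinearMap.range V.mulVecLin) (j : Fin κ₀) :
    krylovVectors A b lam κ₀ κ (Sum.inl j) =
      V *ᵥ krylovVectors (reducedMatrix V A) (reducedVector V b) lam κ₀ κ (Sum.inl j) := by
  obtain ⟨j, hj⟩ := j
  have hproj := mulVec_conjTranspose_mulVec_of_mem_range hV (hmem (Sum.inl ⟨j, hj⟩))
  simp only [krylovVectors, Sum.elim_inl] at hproj ⊢
  induction j with
  | zero => simpa only [pow_zero, Matrix.one_mulVec, reducedVector] using hproj.symm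
  | succ j ih =>
    have hj' : j < κ₀ := Nat.lt_of_succ_lt hj
    rw [← hproj, pow_succ', ← Matrix.mulVec_mulVec,
      ih hj' (mulVec_conjTranspose_mulVec_of_mem_range hV (hmem (Sum.inl ⟨j, hj'⟩)))]
    simp only [reducedMatrix, pow_succ', ← Matrix.mulVec_mulVec]

theorem krylovVectors_inr_eq_mulVec_reduced (hV : Vᴴ * V = 1)
    (hlamA : ∀ k, lam k ∉ spectrum ℂ A) (hlamR : ∀ k, lam k ∉ spectrum ℂ (reducedMatrix V A))
    (hmem : ∀ i, krylovVectors A b lam κ₀ κ i ∈ LinearMap.range V.mulVecLin)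
    (p : Σ k : Fin m, Fin (κ k)) :
    krylovVectors A b lam κ₀ κ (Sum.inr p) =
      V *ᵥ krylovVectors (reducedMatrix V A) (reducedVector V b) lam κ₀ κ (Sum.inr p) := by
  obtain ⟨k, j, hj⟩ := p
  have hrange := hmem (Sum.inr ⟨k, j, hj⟩)
  simp only [krylovVectors, Sum.elim_inr] at hrange ⊢
  induction j with
  | zero =>
    simp only [zero_add, pow_one] at hrange ⊢
    exact resolvent_mulVec_eq_of_mem_range hV (hlamA k) (hlamR k) hrange
  | succ j ih =>
    have hj' : j < κ k := Nat.lt_of_succ_lt hj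
    rw [pow_succ', ← Matrix.mulVec_mulVec] at hrange
    rw [pow_succ', ← Matrix.mulVec_mulVec,
      resolvent_mulVec_eq_of_mem_range hV (hlamA k) (hlamR k) hrange,
      ih hj' (hmem (Sum.inr ⟨k, j, hj'⟩)), conjTranspose_mulVec_mulVec hV, pow_succ' _ (j + 1),
      ← Matrix.mulVec_mulVec]

theorem ratMulVec_eq_mulVec_reduced (hV : Vᴴ * V = 1)
    (hlamA : ∀ k, lam k ∉ spectrum ℂ A) (hlamR : ∀ k, lam k ∉ spectrum ℂ (reducedMatrix V A))
    (hmem : ∀ i, krylovVectors A b lam κ₀ κ i ∈ LinearMap.range V.mulVecLin)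
    (hindep : LinearIndependent ℂ (krylovVectors A b lam κ₀ κ)) {p : ℂ[X]}
    (hp : p ∈ degreeLT ℂ (κ₀ + ∑ k, κ k)) :
    ratMulVec A b (nodePoly lam κ) p =
      V *ᵥ ratMulVec (reducedMatrix V A) (reducedVector V b) (nodePoly lam κ) p := by
  rw [krylovVectors_eq_ratMulVec b hlamA] at hindep
  rw [← span_krylovNumerator hindep.of_comp] at hp
  refine LinearMap.eqOn_span (f := ratMulVec A b (nodePoly lam κ)) (g := V.mulVecLin ∘ₗ
    ratMulVec (reducedMatrix V A) (reducedVector V b) (nodePoly lam κ)) ?_ hp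
  rintro _ ⟨i, rfl⟩
  have hi : krylovVectors A b lam κ₀ κ i =
      V *ᵥ krylovVectors (reducedMatrix V A) (reducedVector V b) lam κ₀ κ i := by
    rcases i with j | p
    · exact krylovVectors_inl_eq_mulVec_reduced hV hmem j
    · exact krylovVectors_inr_eq_mulVec_reduced hV hlamA hlamR hmem p
  rwa [krylovVectors_eq_ratMulVec b hlamA, krylovVectors_eq_ratMulVec _ hlamR] at hi

theorem ratMulVec_X_pow_eq_mulVec_reduced (hV : Vᴴ * V = 1)
    (hlamA : ∀ k, lam k ∉ spectrum ℂ A) (hlamR : ∀ k, lam k ∉ spectrum ℂ (reducedMatrix V A))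
    (hmem : ∀ i, krylovVectors A b lam κ₀ κ i ∈ LinearMap.range V.mulVecLin)
    (hindep : LinearIndependent ℂ (krylovVectors A b lam κ₀ κ)) {j : ℕ}
    (hj : j < κ₀ + ∑ k, κ k) :
    ratMulVec A b (nodePoly lam κ) (X ^ j) =
      V *ᵥ ratMulVec (reducedMatrix V A) (reducedVector V b) (nodePoly lam κ) (X ^ j) :=
  ratMulVec_eq_mulVec_reduced hV hlamA hlamR hmem hindep
    (by rw [mem_degreeLT, degree_X_pow]; exact_mod_cast hj)

-- After projection the matching extends to the exponent `κ₀ + ∑ k, κ k`: `Vᴴ A V` is the reduced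
-- matrix, so one more factor of `A` is absorbed.
theorem conjTranspose_mulVec_ratMulVec_X_pow (hV : Vᴴ * V = 1)
    (hlamA : ∀ k, lam k ∉ spectrum ℂ A) (hlamR : ∀ k, lam k ∉ spectrum ℂ (reducedMatrix V A))
    (hmem : ∀ i, krylovVectors A b lam κ₀ κ i ∈ LinearMap.range V.mulVecLin)
    (hindep : LinearIndependent ℂ (krylovVectors A b lam κ₀ κ)) {j : ℕ}
    (hj : j ≤ κ₀ + ∑ k, κ k) :
    Vᴴ *ᵥ ratMulVec A b (nodePoly lam κ) (X ^ j) =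
      ratMulVec (reducedMatrix V A) (reducedVector V b) (nodePoly lam κ) (X ^ j) := by
  rcases j with - | j
  · rcases (Nat.zero_le _).lt_or_eq with hpos | hzero
    · rw [ratMulVec_X_pow_eq_mulVec_reduced hV hlamA hlamR hmem hindep hpos,
        conjTranspose_mulVec_mulVec hV]
    · have hκ : ∀ k, κ k = 0 := by
        simpa using (Nat.add_eq_zero_iff.1 hzero.symm).2
      simp [ratMulVec, nodePoly, hκ, reducedVector]
  · rw [pow_succ', ratMulVec_X_mul, ratMulVec_X_mul,
      ratMulVec_X_pow_eq_mulVec_reduced hV hlamA hlamR hmem hindep hj]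
    simp only [reducedMatrix, ← Matrix.mulVec_mulVec]

theorem nodePoly_map_conj (lam : Fin m → ℂ) (χ : Fin m → ℕ) :
    (nodePoly lam χ).map (starRingEnd ℂ) = nodePoly (fun k => star (lam k)) χ := by
  simp [nodePoly, Polynomial.map_prod]

theorem star_notMem_spectrum_conjTranspose {ι : Type*} [Fintype ι] [DecidableEq ι]
    {A : Matrix ι ι ℂ} {z : ℂ} (h : z ∉ spectrum ℂ A) : star z ∉ spectrum ℂ Aᴴ := by
  rwa [← Matrix.star_eq_conjTranspose, spectrum.map_star, Set.star_mem_star]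

theorem reducedMatrix_conjTranspose (V : Matrix (Fin n) (Fin nhat) ℂ)
    (A : Matrix (Fin n) (Fin n) ℂ) : reducedMatrix V Aᴴ = (reducedMatrix V A)ᴴ := by
  simp only [reducedMatrix, Matrix.conjTranspose_mul, Matrix.conjTranspose_conjTranspose,
    Matrix.mul_assoc]

theorem star_mulVec_dotProduct (V : Matrix (Fin n) (Fin nhat) ℂ) (x : Fin nhat → ℂ)
    (y : Fin n → ℂ) : star (V *ᵥ x) ⬝ᵥ y = star x ⬝ᵥ (Vᴴ *ᵥ y) := by
  rw [Matrix.star_mulVec, Matrix.dotProduct_mulVec]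

theorem star_dotProduct_mulVec (V : Matrix (Fin n) (Fin nhat) ℂ) (y : Fin n → ℂ)
    (x : Fin nhat → ℂ) : star y ⬝ᵥ (V *ᵥ x) = star (Vᴴ *ᵥ y) ⬝ᵥ x := by
  rw [star_mulVec_dotProduct, Matrix.conjTranspose_conjTranspose]

theorem card_columns_eq
    (hindep : LinearIndependent ℂ (twoSidedKrylovVectors A b d lam κ₀ χ₀ κ χ))
    (hspan : Submodule.span ℂ (Set.range (twoSidedKrylovVectors A b d lam κ₀ χ₀ κ χ)) =
      LinearMap.range V.mulVecLin)
    (hV : Vᴴ * V = 1) : nhat = (κ₀ + ∑ k, κ k) + (χ₀ + ∑ k, χ k) := by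
  have hinj : Function.Injective V.mulVecLin :=
    Function.LeftInverse.injective (g := fun x => Vᴴ *ᵥ x) (conjTranspose_mulVec_mulVec hV)
  have hrank := LinearMap.finrank_range_of_inj hinj
  rw [← hspan, finrank_span_eq_card hindep] at hrank
  simpa using hrank.symm

theorem star_dotProduct_ratMulVec_X_pow_eq_reduced
    (hindep : LinearIndependent ℂ (twoSidedKrylovVectors A b d lam κ₀ χ₀ κ χ))
    (hspan : Submodule.span ℂ (Set.range (twoSidedKrylovVectors A b d lam κ₀ χ₀ κ χ)) =
      LinearMap.range V.mulVecLin)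
    (hV : Vᴴ * V = 1) (hlamA : ∀ k, lam k ∉ spectrum ℂ A)
    (hlamR : ∀ k, lam k ∉ spectrum ℂ (reducedMatrix V A)) {j : ℕ} (hj : j < nhat) :
    star d ⬝ᵥ ratMulVec A b (polePoly lam κ χ) (X ^ j) =
      star (reducedVector V d) ⬝ᵥ
        ratMulVec (reducedMatrix V A) (reducedVector V b) (polePoly lam κ χ) (X ^ j) := by
  have hmem : ∀ i, twoSidedKrylovVectors A b d lam κ₀ χ₀ κ χ i ∈ LinearMap.range V.mulVecLin :=
    fun i => hspan ▸ Submodule.subset_span ⟨i, rfl⟩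
  have hindepb : LinearIndependent ℂ (krylovVectors A b lam κ₀ κ) :=
    hindep.comp Sum.inl Sum.inl_injective
  have hindepd : LinearIndependent ℂ (krylovVectors Aᴴ d (fun k => star (lam k)) χ₀ χ) :=
    hindep.comp Sum.inr Sum.inr_injective
  have hstarA := fun k => star_notMem_spectrum_conjTranspose (hlamA k)
  have hstarR : ∀ k, star (lam k) ∉ spectrum ℂ (reducedMatrix V Aᴴ) := fun k => by
    rw [reducedMatrix_conjTranspose]
    exact star_notMem_spectrum_conjTranspose (hlamR k)
  -- One of the two sides has a power to spare, so the weaker projected matching suffices there.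
  obtain ⟨i, l, rfl, hil⟩ : ∃ i l, i + l = j ∧ ((i < χ₀ + ∑ k, χ k ∧ l ≤ κ₀ + ∑ k, κ k) ∨
      (i ≤ χ₀ + ∑ k, χ k ∧ l < κ₀ + ∑ k, κ k)) := by
    have hcard := card_columns_eq hindep hspan hV
    exact ⟨min j (χ₀ + ∑ k, χ k - 1), j - min j (χ₀ + ∑ k, χ k - 1), by omega, by omega⟩
  rw [polePoly_eq_nodePoly_mul, pow_add, star_dotProduct_ratMulVec_mul,
    star_dotProduct_ratMulVec_mul, nodePoly_map_conj, Polynomial.map_pow, Polynomial.map_X,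
    ← reducedMatrix_conjTranspose]
  rcases hil with ⟨hi, hl⟩ | ⟨hi, hl⟩
  · rw [ratMulVec_X_pow_eq_mulVec_reduced hV hstarA hstarR (fun i => hmem (Sum.inr i)) hindepd hi,
      star_mulVec_dotProduct,
      conjTranspose_mulVec_ratMulVec_X_pow hV hlamA hlamR (fun i => hmem (Sum.inl i)) hindepb hl]
  · rw [ratMulVec_X_pow_eq_mulVec_reduced hV hlamA hlamR (fun i => hmem (Sum.inl i)) hindepb hl,
      star_dotProduct_mulVec, conjTranspose_mulVec_ratMulVec_X_pow hV hstarA hstarR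
        (fun i => hmem (Sum.inr i)) hindepd hi]

end MomentMatching

section ErrorBound

theorem exists_list_prod_X_sub_C_eq_charpoly {N : ℕ} (B : Matrix (Fin N) (Fin N) ℂ) :
    ∃ l : List ℂ, l.length = N ∧ (∀ z ∈ l, z ∈ spectrum ℂ B) ∧
      (l.map fun z => X - C z).prod = B.charpoly := by
  have hsplits := IsAlgClosed.splits B.charpoly
  refine ⟨B.charpoly.roots.toList, ?_, fun z hz => ?_, ?_⟩
  · rw [Multiset.length_toList, ← hsplits.natDegree_eq_card_roots,
      Matrix.charpoly_natDegree_eq_dim, Fintype.card_fin]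
  · rw [Matrix.mem_spectrum_iff_isRoot_charpoly]
    exact isRoot_of_mem_roots (Multiset.mem_toList.1 hz)
  · rw [← Multiset.prod_coe, ← Multiset.map_coe, Multiset.coe_toList]
    exact (hsplits.eq_prod_roots_of_monic B.charpoly_monic).symm

theorem nodePoly_eq_charpoly {N mhat : ℕ} {B : Matrix (Fin N) (Fin N) ℂ} {μ : Fin mhat → ℂ}
    {w : Fin mhat → ℕ} (hμ_inj : Function.Injective μ) (hμ_range : Set.range μ = spectrum ℂ B)
    (hw : ∀ k, w k = B.charpoly.rootMultiplicity (μ k)) : nodePoly μ w = B.charpoly := by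
  have hroots : B.charpoly.roots.toFinset = Finset.univ.image μ := by
    ext z
    rw [Multiset.mem_toFinset, mem_roots B.charpoly_monic.ne_zero,
      ← Matrix.mem_spectrum_iff_isRoot_charpoly, ← hμ_range]
    simp
  rw [(IsAlgClosed.splits B.charpoly).eq_prod_roots_of_monic B.charpoly_monic,
    Finset.prod_multiset_map_count, hroots, Finset.prod_image hμ_inj.injOn, nodePoly]
  exact Finset.prod_congr rfl fun k _ => by rw [hw k, count_roots]

variable {n : ℕ}

/-- The quantity `errorTerm` with an arbitrary function `f` in place of `z ↦ exp (z * t)`. -/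
noncomputable def entireErrorTerm (A : Matrix (Fin n) (Fin n) ℂ) (b d : Fin n → ℂ) (Ω v : ℂ[X])
    (f : ℂ → ℂ) (N : ℕ) (s : ℝ) (μ : ℂ) : ℝ :=
  ‖star d ⬝ᵥ
    ((aeval A Ω * (aeval A v)⁻¹ *
      ((N.factorial : ℂ)⁻¹ •
        entireMatrixFunction (iteratedDeriv N fun z : ℂ => v.eval z * f z)
          (((1 - (s : ℂ)) * μ) • (1 : Matrix (Fin n) (Fin n) ℂ) + (s : ℂ) • A))) *ᵥ b)‖

theorem errorTerm_eq_entireErrorTerm (A : Matrix (Fin n) (Fin n) ℂ) (b d : Fin n → ℂ)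
    (Ω v : ℂ[X]) (N : ℕ) (t s : ℝ) (μ : ℂ) : errorTerm A b d Ω v N t s μ =
      entireErrorTerm A b d Ω v (fun z => Complex.exp (z * t)) N s μ :=
  rfl

section MatrixNorm

open scoped Matrix.Norms.Operator

/-- The linear functional `Y ↦ dᴴ W Y b` on matrices. -/
noncomputable def sandwichFunctional (d : Fin n → ℂ) (W : Matrix (Fin n) (Fin n) ℂ)
    (b : Fin n → ℂ) : Matrix (Fin n) (Fin n) ℂ →L[ℂ] ℂ :=
  LinearMap.toContinuousLinearMap
    { toFun Y := star d ⬝ᵥ ((W * Y) *ᵥ b)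
      map_add' Y Z := by rw [mul_add, Matrix.add_mulVec, dotProduct_add]
      map_smul' c Y := by
        rw [mul_smul_comm, Matrix.smul_mulVec, dotProduct_smul, RingHom.id_apply] }

theorem sandwichFunctional_apply (d : Fin n → ℂ) (W : Matrix (Fin n) (Fin n) ℂ) (b : Fin n → ℂ)
    (Y : Matrix (Fin n) (Fin n) ℂ) : sandwichFunctional d W b Y = star d ⬝ᵥ ((W * Y) *ᵥ b) :=
  rfl

variable {f : ℂ → ℂ}

theorem differentiable_iteratedDeriv_eval_mul (hf : Differentiable ℂ f) (v : ℂ[X]) (N : ℕ) :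
    Differentiable ℂ (iteratedDeriv N fun z => v.eval z * f z) :=
  (v.differentiable.mul hf).contDiff.differentiable_iteratedDeriv' N

theorem entireErrorTerm_eq (hf : Differentiable ℂ f) (A : Matrix (Fin n) (Fin n) ℂ)
    (b d : Fin n → ℂ) (Ω v : ℂ[X]) (N : ℕ) (s : ℝ) (μ : ℂ) :
    entireErrorTerm A b d Ω v f N s μ = (N.factorial : ℝ)⁻¹ *
      ‖sandwichFunctional d (aeval A v)⁻¹ b (aeval A Ω *
        entireEval (iteratedDeriv N fun z => v.eval z * f z)
          (algebraMap ℂ _ ((1 - (s : ℂ)) * μ) + (s : ℂ) • A))‖ := by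
  rw [entireErrorTerm, entireMatrixFunction_eq_entireEval
    (differentiable_iteratedDeriv_eval_mul hf v N), mul_smul_comm, Matrix.smul_mulVec,
    dotProduct_smul, norm_smul, norm_inv, Complex.norm_natCast, sandwichFunctional_apply,
    ← mul_assoc, (commute_inv_aeval_aeval A v Ω).eq, Algebra.algebraMap_eq_smul_one]

theorem continuous_entireErrorTerm (hf : Differentiable ℂ f) (A : Matrix (Fin n) (Fin n) ℂ)
    (b d : Fin n → ℂ) (Ω v : ℂ[X]) (N : ℕ) :
    Continuous fun x : ℝ × ℂ => entireErrorTerm A b d Ω v f N x.1 x.2 := by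
  simp only [entireErrorTerm_eq hf]
  have hpath : Continuous fun x : ℝ × ℂ =>
      algebraMap ℂ (Matrix (Fin n) (Fin n) ℂ) ((1 - (x.1 : ℂ)) * x.2) + (x.1 : ℂ) • A := by
    simp only [Algebra.algebraMap_eq_smul_one]
    fun_prop
  have heval := (continuous_entireEval (differentiable_iteratedDeriv_eval_mul hf v N)).comp hpath
  exact ((sandwichFunctional d _ b).continuous.comp (heval.const_mul _)).norm.const_mul _

theorem exists_isGreatest_entireErrorTerm (hf : Differentiable ℂ f)
    (A : Matrix (Fin n) (Fin n) ℂ) (b d : Fin n → ℂ) (Ω v : ℂ[X]) (N : ℕ) {K : Set ℂ}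
    (hK : IsCompact K) (hK₀ : K.Nonempty) :
    ∃ M, IsGreatest {x : ℝ | ∃ s ∈ Set.Icc (0 : ℝ) 1, ∃ μ ∈ K,
      x = entireErrorTerm A b d Ω v f N s μ} M := by
  obtain ⟨M, hM⟩ := ((isCompact_Icc.prod hK).image
    (continuous_entireErrorTerm hf A b d Ω v N)).exists_isGreatest
      (((Set.nonempty_Icc.2 (zero_le_one' ℝ)).prod hK₀).image _)
  refine ⟨M, ?_⟩
  convert! hM using 1
  ext x
  simp only [Set.mem_ofPred_eq, Set.mem_image, Set.mem_prod, Prod.exists, and_assoc,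
    exists_and_left, eq_comm]

theorem sandwichFunctional_entireEval_eval_mul (hf : Differentiable ℂ f)
    {A : Matrix (Fin n) (Fin n) ℂ} (b d : Fin n → ℂ) {v : ℂ[X]} (hv : IsUnit (aeval A v)) :
    sandwichFunctional d (aeval A v)⁻¹ b (entireEval (fun z => v.eval z * f z) A) =
      star d ⬝ᵥ (entireMatrixFunction f A *ᵥ b) := by
  rw [sandwichFunctional_apply, entireEval_mul v.differentiable hf, entireEval_aeval,
    Matrix.nonsing_inv_mul_cancel_left _ _ ((Matrix.isUnit_iff_isUnit_det _).1 hv),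
    entireMatrixFunction_eq_entireEval hf]

theorem norm_dotProduct_sub_le_of_forall_entireErrorTerm_le {N : ℕ} (hN : 0 < N)
    {A : Matrix (Fin n) (Fin n) ℂ} {b d : Fin n → ℂ} {B : Matrix (Fin N) (Fin N) ℂ}
    {b' d' : Fin N → ℂ} {v : ℂ[X]} (hvA : IsUnit (aeval A v)) (hvB : IsUnit (aeval B v))
    (hmatch : ∀ j < N, star d ⬝ᵥ ratMulVec A b v (X ^ j) = star d' ⬝ᵥ ratMulVec B b' v (X ^ j))
    (hf : Differentiable ℂ f) {M : ℝ}
    (hM : ∀ s ∈ Set.Icc (0 : ℝ) 1, ∀ μ ∈ convexHull ℝ (spectrum ℂ B),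
      entireErrorTerm A b d B.charpoly v f N s μ ≤ M) :
    ‖star d ⬝ᵥ (entireMatrixFunction f A *ᵥ b) - star d' ⬝ᵥ (entireMatrixFunction f B *ᵥ b')‖ ≤
      M := by
  obtain ⟨l, rfl, hlmem, hprod⟩ := exists_list_prod_X_sub_C_eq_charpoly B
  have hl : ∀ μ ∈ l, μ ∈ convexHull ℝ (spectrum ℂ B) := fun μ hμ =>
    subset_convexHull ℝ _ (hlmem μ hμ)
  have hne : (convexHull ℝ (spectrum ℂ B)).Nonempty :=
    (List.exists_mem_of_length_pos hN).imp hl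
  have hannihilates : aeval B (l.map fun μ => X - C μ).prod = 0 := by
    rw [hprod, Matrix.aeval_self_charpoly]
  have hpow : ∀ j < l.length, sandwichFunctional d (aeval A v)⁻¹ b (A ^ j) =
      sandwichFunctional d' (aeval B v)⁻¹ b' (B ^ j) := fun j hj => by
    rw [sandwichFunctional_apply, sandwichFunctional_apply]
    simpa only [ratMulVec, LinearMap.coe_mk, AddHom.coe_mk, map_pow, aeval_X] using hmatch j hj
  have hfactorial : (0 : ℝ) < l.length.factorial := by positivity
  have hbound := norm_apply_entireEval_sub_le (convex_convexHull ℝ _) hne hl hannihilates hpow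
    (v.differentiable.mul hf) (M := l.length.factorial * M) fun s hs μ hμ => by
      rw [hprod, ← inv_mul_le_iff₀ hfactorial]
      exact (entireErrorTerm_eq hf A b d B.charpoly v l.length s μ).symm.trans_le (hM s hs μ hμ)
  rw [← sandwichFunctional_entireEval_eval_mul hf b d hvA,
    ← sandwichFunctional_entireEval_eval_mul hf b' d' hvB]
  exact hbound.trans_eq (mul_div_cancel_left₀ M hfactorial.ne')

theorem impulseResponse_eq (A : Matrix (Fin n) (Fin n) ℂ) (b d : Fin n → ℂ) (t : ℝ) :
    impulseResponse A b d t =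
      star d ⬝ᵥ (entireMatrixFunction (fun z => Complex.exp (z * t)) A *ᵥ b) := by
  rw [entireMatrixFunction_eq_entireEval (by fun_prop), entireEval_cexp_mul]
  rfl

end MatrixNorm

end ErrorBound

theorem theoremt_general {n nhat m mhat : ℕ} (hnhat : 0 < nhat)
    (A : Matrix (Fin n) (Fin n) ℂ) (b d : Fin n → ℂ)
    (V : Matrix (Fin n) (Fin nhat) ℂ)
    (lam : Fin m → ℂ) (κ₀ χ₀ : ℕ) (κ χ : Fin m → ℕ)
    (hindep : LinearIndependent ℂ (twoSidedKrylovVectors A b d lam κ₀ χ₀ κ χ))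
    (hspan : Submodule.span ℂ (Set.range (twoSidedKrylovVectors A b d lam κ₀ χ₀ κ χ)) =
      LinearMap.range V.mulVecLin)
    (hV : Vᴴ * V = 1)
    (hlamA : ∀ k, lam k ∉ spectrum ℂ A)
    (hlamR : ∀ k, lam k ∉ spectrum ℂ (reducedMatrix V A))
    (μhat : Fin mhat → ℂ) (what : Fin mhat → ℕ)
    (hμ_inj : Function.Injective μhat)
    (hμ_range : Set.range μhat = spectrum ℂ (reducedMatrix V A))
    (hwhat : ∀ k, what k = (reducedMatrix V A).charpoly.rootMultiplicity (μhat k))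
    {f : ℂ → ℂ} (hf : Differentiable ℂ f) :
    ∃ M : ℝ,
      IsGreatest
        {x : ℝ | ∃ s ∈ Set.Icc (0 : ℝ) 1, ∃ μ ∈ convexHull ℝ (Set.range μhat),
          x = entireErrorTerm A b d (nodePoly μhat what) (polePoly lam κ χ) f nhat s μ} M ∧
      ‖star d ⬝ᵥ (entireMatrixFunction f A *ᵥ b) - star (reducedVector V d) ⬝ᵥ
        (entireMatrixFunction f (reducedMatrix V A) *ᵥ reducedVector V b)‖ ≤ M := by
  have : Nonempty (Fin nhat) := ⟨⟨0, hnhat⟩⟩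
  have hcompact := (Set.finite_range μhat).isCompact_convexHull ℝ
  have hne : (Set.range μhat).Nonempty :=
    hμ_range ▸ spectrum.nonempty_of_isAlgClosed_of_finiteDimensional ℂ (reducedMatrix V A)
  obtain ⟨M, hM⟩ := exists_isGreatest_entireErrorTerm hf A b d (nodePoly μhat what)
    (polePoly lam κ χ) nhat hcompact (hne.mono (subset_convexHull ℝ _))
  refine ⟨M, hM, norm_dotProduct_sub_le_of_forall_entireErrorTerm_le hnhat
    (isUnit_aeval_polePoly hlamA κ χ) (isUnit_aeval_polePoly hlamR κ χ)
    (fun j hj => star_dotProduct_ratMulVec_X_pow_eq_reduced hindep hspan hV hlamA hlamR hj) hf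
    fun s hs μ hμ => ?_⟩
  rw [← nodePoly_eq_charpoly hμ_inj hμ_range hwhat]
  exact hM.2 ⟨s, hs, μ, hμ_range ▸ hμ, rfl⟩

theorem theoremt {n nhat m mhat : ℕ} (hnhat : 0 < nhat)
    (A : Matrix (Fin n) (Fin n) ℂ) (b d : Fin n → ℂ)
    (V : Matrix (Fin n) (Fin nhat) ℂ)
    (lam : Fin m → ℂ) (κ₀ χ₀ : ℕ) (κ χ : Fin m → ℕ)
    -- the Krylov vectors form a basis in the image of `V`
    (hindep : LinearIndependent ℂ (twoSidedKrylovVectors A b d lam κ₀ χ₀ κ χ))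
    (hspan : Submodule.span ℂ (Set.range (twoSidedKrylovVectors A b d lam κ₀ χ₀ κ χ)) =
      LinearMap.range V.mulVecLin)
    (hV : Vᴴ * V = 1)
    -- the poles lie neither in the spectrum of `A` nor in that of the reduced matrix
    (hlamA : ∀ k, lam k ∉ spectrum ℂ A)
    (hlamR : ∀ k, lam k ∉ spectrum ℂ (reducedMatrix V A))
    -- the eigenvalues of the reduced matrix, with their algebraic multiplicities
    (μhat : Fin mhat → ℂ) (what : Fin mhat → ℕ)
    (hμ_inj : Function.Injective μhat)
    (hμ_range : Set.range μhat = spectrum ℂ (reducedMatrix V A))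
    (hwhat : ∀ k, what k = (reducedMatrix V A).charpoly.rootMultiplicity (μhat k))
    (t : ℝ) :
    ∃ M : ℝ,
      IsGreatest
        {x : ℝ | ∃ s ∈ Set.Icc (0 : ℝ) 1, ∃ μ ∈ convexHull ℝ (Set.range μhat),
          x = errorTerm A b d (nodePoly μhat what) (polePoly lam κ χ) nhat t s μ} M ∧
      ‖impulseResponse A b d t -
        impulseResponse (reducedMatrix V A) (reducedVector V b) (reducedVector V d) t‖ ≤ M := by
  have hexp : Differentiable ℂ fun z : ℂ => Complex.exp (z * t) := by fun_prop
  simpa only [impulseResponse_eq, errorTerm_eq_entireErrorTerm] using theoremt_general hnhat A b d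
    V lam κ₀ χ₀ κ χ hindep hspan hV hlamA hlamR μhat what hμ_inj hμ_range hwhat hexp
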